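/- Let $\mathcal{A}$ be a finite alphabet and let $\mathcal{A}^+$ be the set of non-empty finite words over $\mathcal{A}$. Let $\vartheta$ be a random substitution on $\mathcal{A}$: a map sending each letter $a$ to a non-empty finite set $\vartheta(a) \subset \mathcal{A}^+$ (the realisations of $a$), together with, for each $a$, a strictly positive probability vector on $\vartheta(a)$ (these vectors play no role below). For a word $v = v_1 \cdots v_n$ put $\vartheta(v) = \{ w_1 \cdots w_n : w_i \in \vartheta(v_i) \}$, and put $\vartheta^0(a) = \{a\}$ and $\vartheta^{k}(a) = \bigcup_{v \in \vartheta^{k-1}(a)} \vartheta(v)$ for $k \geq 1$. Let $\mathcal{L}_\vartheta$ be the set of non-empty words that occur as contiguous subwords of some word in $\vartheta^k(a)$, for some $a \in \mathcal{A}$ and $k \geq 1$, and let $X_\vartheta$ be the set of $x \in \mathcal{A}^{\mathbb{Z}}$ all of whose non-empty finite subwords lie in $\mathcal{L}_\vartheta$. Suppose that * $\vartheta$ is primitive: there is $k \geq 1$ such that for all $a, b \in \mathcal{A}$ the letter $a$ occurs in some word of $\vartheta^k(b)$; and, as part of the definition, $X_\vartheta \neq \emptyset$; * $\vartheta$ has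 unique realisation paths: for every $v = v_1 \cdots v_n \in \mathcal{L}_\vartheta$ and every $k \geq 1$, the concatenation map $(w_1, \ldots, w_n) \mapsto w_1 \cdots w_n$ is injective on $\vartheta^k(v_1) \times \cdots \times \vartheta^k(v_n)$; * there is a letter $b \in \mathcal{A}$ with $\# \vartheta(b) \geq 2$. For $n \in \mathbb{N}$, let $p(n)$ be the number of words of length $n$ that occur as subwords of elements of $X_\vartheta$. Then the limit $$h_{\mathrm{top}}(X_\vartheta) = \lim_{n \to \infty} \frac{1}{n} \log p(n),$$ which is the topological entropy of $X_\vartheta$, exists and satisfies $h_{\mathrm{top}}(X_\vartheta) > 0$. -/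

import Mathlib

open Filter Topology

/-- A random substitution on the alphabet `A`: every letter `a` is sent to a non-empty finite set
of non-empty words (its realisations), together with a non-degenerate probability vector indexed
by these realisations. Words are lists of letters. -/
structure RandomSubstitution (A : Type*) where
  /-- The set of realisations of a letter. -/
  realisations : A → Finset (List A)
  realisations_nonempty : ∀ a, (realisations a).Nonempty
  ne_nil_of_mem : ∀ a, ∀ u ∈ realisations a, u ≠ []
  /-- The probability with which a letter is sent to a given realisation. -/
  prob : (a : A) → realisations a → ℝ
  prob_pos : ∀ a u, 0 < prob a u
  sum_prob : ∀ a, ∑ u, prob a u = 1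

/-- The concatenation `w₁ w₂ ⋯ wₙ` of an `n`-tuple of words. -/
def concatWords {A : Type*} {n : ℕ} (w : Fin n → List A) : List A :=
  (List.ofFn w).flatten

/-- For a function `S` from letters to sets of words and a word `v = v₁ ⋯ vₙ`, the product
`S(v₁) × ⋯ × S(vₙ)`. -/
def wordProduct {A : Type*} (S : A → Set (List A)) (v : List A) :
    Set (Fin v.length → List A) :=
  {w | ∀ i, w i ∈ S (v.get i)}

/-- The language of a bi-infinite sequence: the non-empty finite words
`x i, x (i + 1), …, x (i + n - 1)` that appear in it. -/
def sequenceLanguage {A : Type*} (x : ℤ → A) : Set (List A) :=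
  {u | u ≠ [] ∧ ∃ i : ℤ, u = List.ofFn fun j : Fin u.length => x (i + (j : ℕ))}

/-- The language of a set of bi-infinite sequences. -/
def languageOf {A : Type*} (X : Set (ℤ → A)) : Set (List A) :=
  {u | ∃ x ∈ X, u ∈ sequenceLanguage x}

/-- The complexity function: the number of words of length `n` in the language of `X`. -/
noncomputable def complexity {A : Type*} (X : Set (ℤ → A)) (n : ℕ) : ℕ :=
  {u | u ∈ languageOf X ∧ u.length = n}.ncard

/-- The topological entropy `lim_{n → ∞} (1 / n) log p_X(n)`, where `p_X` is the complexity
function of the subshift `X`. -/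
noncomputable def topEntropy {A : Type*} (X : Set (ℤ → A)) : ℝ :=
  limUnder atTop fun n : ℕ => 1 / (n : ℝ) * Real.log (complexity X n)

namespace RandomSubstitution

/-- The set `ϑ(v)` of realisations of a word `v`: the substitution is applied independently to
every letter of `v` and the results are concatenated in order. -/
def image {A : Type*} (ϑ : RandomSubstitution A) (v : List A) : Set (List A) :=
  concatWords '' wordProduct (fun a => (ϑ.realisations a : Set (List A))) v

/-- The set `ϑ^k(a)` of realisations of a letter under the `k`-th power of `ϑ`. -/
def power {A : Type*} (ϑ : RandomSubstitution A) : ℕ → A → Set (List A)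
  | 0, a => {[a]}
  | k + 1, a => ⋃ v ∈ ϑ.power k a, ϑ.image v

/-- The language of `ϑ`: the non-empty words that are (contiguous) subwords of a word in
`ϑ^k(a)`, for some letter `a` and some positive integer `k`. -/
def language {A : Type*} (ϑ : RandomSubstitution A) : Set (List A) :=
  {u | u ≠ [] ∧ ∃ (a : A) (k : ℕ), 1 ≤ k ∧ ∃ v ∈ ϑ.power k a, u <:+: v}

/-- The subshift associated with `ϑ`: the bi-infinite sequences all of whose finite subwords lie
in the language of `ϑ`. -/
def subshift {A : Type*} (ϑ : RandomSubstitution A) : Set (ℤ → A) :=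
  {x | sequenceLanguage x ⊆ ϑ.language}

/-- `ϑ` is primitive if for some positive integer `k` every letter `a` appears in a realisation
of `ϑ^k(b)`, for every letter `b`. As usual, the definition is restricted to those `ϑ` whose
subshift is non-empty, that is, not all realisations are single letters. -/
structure IsPrimitive {A : Type*} (ϑ : RandomSubstitution A) : Prop where
  exists_power : ∃ k : ℕ, 1 ≤ k ∧ ∀ a b : A, ∃ w ∈ ϑ.power k b, a ∈ w
  subshift_nonempty : ϑ.subshift.Nonempty

/-- `ϑ` has unique realisation paths if for every word `v = v₁ ⋯ vₙ` in the language of `ϑ` and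
every positive integer `k` the concatenation map is injective on `ϑ^k(v₁) × ⋯ × ϑ^k(vₙ)`. -/
def HasUniqueRealisationPaths {A : Type*} (ϑ : RandomSubstitution A) : Prop :=
  ∀ v ∈ ϑ.language, ∀ k : ℕ, 1 ≤ k → Set.InjOn concatWords (wordProduct (ϑ.power k) v)

end RandomSubstitution

/-!
The limit exists by Fekete's lemma: cutting a word of length `m + n` after `m` letters shows that
the complexity function `p` of any subshift is submultiplicative, so `log p` is subadditive.

Positivity is a counting argument. Since the subshift `X` is non-empty, the language `L` of `ϑ`
contains a word `y` of every length `n`. By primitivity there is `K` such that every letter `c` has a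
realisation `g c ∈ ϑ^K(c)` in which `b` occurs; replacing each letter `c` of `y` by `g c` gives a word
`w ∈ L`, of length at most a constant times `n`, in which `b` occurs at least `n` times. Unique
realisation paths make concatenation injective on the realisations of `w`, so `ϑ(w)` has at least
`2 ^ n` elements (`pow_count_le_ncard_image`), all of them words in `L` of length at most `C * n`
with `C` independent of `n` (`exists_two_pow_le_ncard`).

These words are words of `X`: the language of `X` contains `L` (`mem_languageOf_subshift`).
Indeed, if `u` occurs in `v ∈ ϑ^k(a)`, take a word of length `2 N + 1` in `L`, replace its letters by
realisations under `ϑ^K` that contain `a`, then replace every `a` by `v`. The result contains `u` with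
at least `N` letters on each side, and a limit along an ultrafilter as `N → ∞` is an element of `X`
containing `u`. In particular words of `X` extend to the right, so `p` is monotone on positive
lengths and `2 ^ n ≤ (C * n + 1) * p (C * n)`. Hence the entropy is at least `log 2 / C`.
-/

/-! ### Images of words under a set-valued map on letters -/

/-- The set of words obtained from `v` by replacing each letter `a` by an element of `S a`,
defined by recursion on `v`; it is the image of `wordProduct S v` under `concatWords`. -/
def wordImage {A : Type*} (S : A → Set (List A)) : List A → Set (List A)
  | [] => {[]}
  | a :: v => Set.image2 (· ++ ·) (S a) (wordImage S v)

theorem image_concatWords_wordProduct {A : Type*} (S : A → Set (List A)) (v : List A) :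
    concatWords '' wordProduct S v = wordImage S v := by
  induction v with
  | nil =>
    ext w
    simp only [wordImage, Set.mem_image, Set.mem_singleton_iff]
    constructor
    · rintro ⟨f, -, rfl⟩
      simp [concatWords]
    · rintro rfl
      exact ⟨fun _ => [], fun i => i.elim0, by simp [concatWords]⟩
  | cons a v ih =>
    ext w
    simp only [wordImage, ← ih, Set.mem_image2, Set.mem_image]
    constructor
    · rintro ⟨f, hf, rfl⟩
      refine ⟨f 0, hf 0, _, ⟨fun i => f i.succ, fun i => hf i.succ, rfl⟩, ?_⟩
      simp [concatWords, List.ofFn_succ]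
    · rintro ⟨r, hr, _, ⟨f, hf, rfl⟩, rfl⟩
      refine ⟨Fin.cons (α := fun _ => List A) r f, ?_, ?_⟩
      · intro i
        refine Fin.cases ?_ (fun j => ?_) i
        · simpa using hr
        · simpa using hf j
      · simp [concatWords, List.ofFn_succ]

theorem append_mem_wordImage {A : Type*} {S : A → Set (List A)} {v v' w w' : List A}
    (h : w ∈ wordImage S v) (h' : w' ∈ wordImage S v') : w ++ w' ∈ wordImage S (v ++ v') := by
  induction v generalizing w with
  | nil =>
    simp only [wordImage, Set.mem_singleton_iff] at h
    simpa [h] using h'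
  | cons a v ih =>
    obtain ⟨r, hr, t, ht, rfl⟩ := h
    exact ⟨r, hr, t ++ w', ih ht, by simp⟩

theorem flatMap_mem_wordImage {A B : Type*} {S : A → Set (List A)} {f : B → List A}
    {z : B → List A} (h : ∀ c, f c ∈ wordImage S (z c)) (v : List B) :
    v.flatMap f ∈ wordImage S (v.flatMap z) := by
  induction v with
  | nil => simp [wordImage]
  | cons c v ih => simpa using append_mem_wordImage (h c) ih

theorem wordImage_singleton {A : Type*} (S : A → Set (List A)) (a : A) :
    wordImage S [a] = S a := by
  ext w
  simp [wordImage]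

theorem length_le_of_mem_wordImage {A : Type*} {S : A → Set (List A)} {M : ℕ}
    (hM : ∀ a, ∀ r ∈ S a, r.length ≤ M) {v w : List A} (h : w ∈ wordImage S v) :
    w.length ≤ M * v.length := by
  induction v generalizing w with
  | nil => simp_all [wordImage]
  | cons a v ih =>
    obtain ⟨r, hr, t, ht, rfl⟩ := h
    have := hM a r hr
    have := ih ht
    simp only [List.length_append, List.length_cons, Nat.mul_succ]
    omega

theorem length_le_of_mem_wordImage_of_ne_nil {A : Type*} {S : A → Set (List A)}
    (hS : ∀ a, ∀ r ∈ S a, r ≠ []) {v w : List A} (h : w ∈ wordImage S v) :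
    v.length ≤ w.length := by
  induction v generalizing w with
  | nil => simp
  | cons a v ih =>
    obtain ⟨r, hr, t, ht, rfl⟩ := h
    have := List.length_pos_iff.2 (hS a r hr)
    have := ih ht
    simp only [List.length_append, List.length_cons]
    omega

theorem length_le_length_flatMap {A B : Type*} {f : B → List A} (hf : ∀ c, f c ≠ [])
    (v : List B) : v.length ≤ (v.flatMap f).length := by
  induction v with
  | nil => simp
  | cons c v ih =>
    have := List.length_pos_iff.2 (hf c)
    simp only [List.flatMap_cons, List.length_append, List.length_cons]
    omega

theorem length_flatMap_le {A B : Type*} {f : B → List A} {M : ℕ} (hf : ∀ c, (f c).length ≤ M)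
    (v : List B) : (v.flatMap f).length ≤ M * v.length := by
  induction v with
  | nil => simp
  | cons c v ih =>
    have := hf c
    simp only [List.flatMap_cons, List.length_append, List.length_cons, Nat.mul_succ]
    omega

theorem length_le_count_flatMap {A B : Type*} [DecidableEq A] {f : B → List A} {b : A}
    (hf : ∀ c, b ∈ f c) (v : List B) : v.length ≤ (v.flatMap f).count b := by
  induction v with
  | nil => simp
  | cons c v ih =>
    have := List.count_pos_iff.2 (hf c)
    simp only [List.flatMap_cons, List.count_append, List.length_cons]
    omega

/-! ### The language of a random substitution -/

namespace RandomSubstitution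

variable {A : Type*} (ϑ : RandomSubstitution A)

theorem image_eq_wordImage (v : List A) :
    ϑ.image v = wordImage (fun a => (ϑ.realisations a : Set (List A))) v :=
  image_concatWords_wordProduct _ _

theorem power_one (a : A) : ϑ.power 1 a = (ϑ.realisations a : Set (List A)) := by
  simp [power, image_eq_wordImage, wordImage_singleton]

theorem mem_power_succ {k : ℕ} {a : A} {w : List A} :
    w ∈ ϑ.power (k + 1) a ↔ ∃ v ∈ ϑ.power k a, w ∈ ϑ.image v := by
  simp [power]

theorem ne_nil_of_mem_power {k : ℕ} {a : A} {w : List A} (h : w ∈ ϑ.power k a) : w ≠ [] := by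
  induction k generalizing w with
  | zero =>
    rw [power, Set.mem_singleton_iff] at h
    simp [h]
  | succ k ih =>
    obtain ⟨v, hv, hw⟩ := ϑ.mem_power_succ.1 h
    rw [image_eq_wordImage] at hw
    have := length_le_of_mem_wordImage_of_ne_nil (fun a r hr => ϑ.ne_nil_of_mem a r hr) hw
    exact List.length_pos_iff.1 ((List.length_pos_iff.2 (ih hv)).trans_le this)

theorem image_nonempty (v : List A) : (ϑ.image v).Nonempty := by
  choose f hf using ϑ.realisations_nonempty
  rw [image_eq_wordImage]
  have := flatMap_mem_wordImage (S := fun a => (ϑ.realisations a : Set (List A))) (f := f)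
    (z := fun c => [c]) (fun c => by rw [wordImage_singleton]; exact hf c) v
  exact ⟨_, by simpa using this⟩

theorem power_nonempty (k : ℕ) (a : A) : (ϑ.power k a).Nonempty := by
  induction k with
  | zero => exact ⟨_, rfl⟩
  | succ k ih =>
    obtain ⟨v, hv⟩ := ih
    obtain ⟨w, hw⟩ := ϑ.image_nonempty v
    exact ⟨w, ϑ.mem_power_succ.2 ⟨v, hv, hw⟩⟩

theorem flatMap_mem_power_add {j k : ℕ} {a : A} {v : List A} (hv : v ∈ ϑ.power j a)
    {g : A → List A} (hg : ∀ c, g c ∈ ϑ.power k c) : v.flatMap g ∈ ϑ.power (j + k) a := by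
  induction k generalizing g with
  | zero =>
    have : g = fun c => [c] := funext hg
    simpa [this] using hv
  | succ k ih =>
    choose z hz hgz using fun c => ϑ.mem_power_succ.1 (hg c)
    refine ϑ.mem_power_succ.2 ⟨v.flatMap z, ih hz, ?_⟩
    rw [image_eq_wordImage]
    exact flatMap_mem_wordImage (fun c => by rw [← image_eq_wordImage]; exact hgz c) v

variable {ϑ}

theorem language_infix {u v : List A} (hv : v ∈ ϑ.language) (hu : u ≠ []) (h : u <:+: v) :
    u ∈ ϑ.language := by
  obtain ⟨-, a, k, hk, w, hw, hvw⟩ := hv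
  exact ⟨hu, a, k, hk, w, hw, h.trans hvw⟩

theorem flatMap_mem_language {k : ℕ} {v : List A} (hv : v ∈ ϑ.language) {g : A → List A}
    (hg : ∀ c, g c ∈ ϑ.power k c) : v.flatMap g ∈ ϑ.language := by
  obtain ⟨hne, a, j, hj, w, hw, s, t, rfl⟩ := hv
  refine ⟨?_, a, j + k, by omega, _, ϑ.flatMap_mem_power_add hw hg, s.flatMap g, t.flatMap g,
    by simp⟩
  exact List.length_pos_iff.1 ((List.length_pos_iff.2 hne).trans_le
    (length_le_length_flatMap (fun c => ϑ.ne_nil_of_mem_power (hg c)) v))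

theorem image_subset_language {v : List A} (hv : v ∈ ϑ.language) : ϑ.image v ⊆ ϑ.language := by
  intro z hz
  obtain ⟨hne, a, j, hj, w, hw, s, t, rfl⟩ := hv
  obtain ⟨s', hs⟩ := ϑ.image_nonempty s
  obtain ⟨t', ht⟩ := ϑ.image_nonempty t
  rw [image_eq_wordImage] at hz hs ht
  refine ⟨?_, a, j + 1, by omega, s' ++ z ++ t', ϑ.mem_power_succ.2 ⟨_, hw, ?_⟩, s', t', rfl⟩
  · exact List.length_pos_iff.1 ((List.length_pos_iff.2 hne).trans_le
      (length_le_of_mem_wordImage_of_ne_nil (fun a r hr => ϑ.ne_nil_of_mem a r hr) hz))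
  · rw [image_eq_wordImage]
    exact append_mem_wordImage (append_mem_wordImage hs hz) ht

theorem exists_mem_language_length (hX : ϑ.subshift.Nonempty) {n : ℕ} (hn : n ≠ 0) :
    ∃ y ∈ ϑ.language, y.length = n := by
  obtain ⟨x, hx⟩ := hX
  refine ⟨List.ofFn fun j : Fin n => x (0 + (j : ℕ)), hx ⟨by simpa using hn, 0, ?_⟩, by simp⟩
  exact List.ext_getElem (by simp) (by simp)

/-! ### Words of the substitution occur in the subshift -/

/-- Every word of the language occurs in a longer word of the language, with arbitrarily many
letters on both sides. -/
theorem exists_append_mem_language (hprim : ϑ.IsPrimitive) {u : List A} (hu : u ∈ ϑ.language)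
    (N : ℕ) : ∃ p q : List A, N ≤ p.length ∧ N ≤ q.length ∧ p ++ u ++ q ∈ ϑ.language := by
  classical
  obtain ⟨K, -, hK⟩ := hprim.exists_power
  obtain ⟨-, a, k, -, v, hv, s, t, hst⟩ := hu
  choose g hg hag using hK a
  choose e he using ϑ.power_nonempty k
  obtain ⟨f, hf, hfa⟩ : ∃ f : A → List A, (∀ c, f c ∈ ϑ.power k c) ∧ f a = v := by
    refine ⟨Function.update e a v, fun c => ?_, by simp⟩
    rcases eq_or_ne c a with rfl | h
    · simpa using hv
    · simpa [h] using he c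
  obtain ⟨y, hy, hlen⟩ := exists_mem_language_length hprim.subshift_nonempty
    (n := N + (N + 1)) (by omega)
  have hmem := flatMap_mem_language (flatMap_mem_language hy hg) hf
  have hle (l : List A) : l.length ≤ ((l.flatMap g).flatMap f).length :=
    (length_le_length_flatMap (fun c => ϑ.ne_nil_of_mem_power (hg c)) l).trans
      (length_le_length_flatMap (fun c => ϑ.ne_nil_of_mem_power (hf c)) _)
  -- The middle letter of `y` is replaced by a word that contains `u`.
  obtain ⟨y₁, c, y₂, rfl, h₁⟩ : ∃ y₁ c y₂, y = y₁ ++ c :: y₂ ∧ y₁.length = N := by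
    refine ⟨y.take N, y[N], y.drop (N + 1), ?_, by simp; omega⟩
    simp
  have h₂ : y₂.length = N := by
    simp only [List.length_append, List.length_cons] at hlen
    omega
  obtain ⟨l, r, hlr⟩ := List.append_of_mem (hag c)
  refine ⟨(y₁.flatMap g).flatMap f ++ l.flatMap f ++ s, t ++ r.flatMap f ++ (y₂.flatMap g).flatMap f,
    ?_, ?_, ?_⟩
  · have := hle y₁
    simp only [List.length_append]
    omega
  · have := hle y₂
    simp only [List.length_append]
    omega
  · convert hmem using 1
    simp only [List.flatMap_append, List.flatMap_cons, hlr, hfa, ← hst, List.append_assoc]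

/-- The language of the subshift contains the language of the substitution; the sequence containing
a given word is a limit of longer and longer words along an ultrafilter. -/
theorem mem_languageOf_subshift [Finite A] (hprim : ϑ.IsPrimitive) {u : List A}
    (hu : u ∈ ϑ.language) : u ∈ languageOf ϑ.subshift := by
  choose p q hp hq hmem using exists_append_mem_language hprim hu
  have hne : u ≠ [] := hu.1
  let d : A := u.head hne
  -- The word `p N ++ u ++ q N`, with the first letter of `u` at position `0`.
  let y (N : ℕ) (i : ℤ) : A := (p N ++ u ++ q N).getD (i + (p N).length).toNat d
  have hlim (i : ℤ) : ∃ a, ∀ᶠ N in (hyperfilter ℕ : Filter ℕ), y N i = a := by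
    obtain ⟨a, ha⟩ := Ultrafilter.eq_pure_of_finite ((hyperfilter ℕ).map fun N => y N i)
    refine ⟨a, ?_⟩
    have : {a} ∈ (hyperfilter ℕ).map fun N => y N i := by simp [ha]
    exact this
  choose x hx using hlim
  have hx' (i : ℤ) (n : ℕ) : ∀ᶠ N in (hyperfilter ℕ : Filter ℕ),
      ∀ j : Fin n, y N (i + (j : ℕ)) = x (i + (j : ℕ)) :=
    eventually_all.2 fun j => hx _
  have hlarge (n : ℕ) : ∀ᶠ N in (hyperfilter ℕ : Filter ℕ), n ≤ N :=
    (eventually_ge_atTop n).filter_mono Nat.hyperfilter_le_atTop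
  refine ⟨x, ?_, hne, 0, ?_⟩
  · rintro w ⟨hw, i, hwi⟩
    obtain ⟨N, hN, hlt⟩ := ((hx' i w.length).and (hlarge (i.natAbs + w.length))).exists
    have h₁ := hp N
    have h₂ := hq N
    refine language_infix (hmem N) hw ?_
    have hw' : w = ((p N ++ u ++ q N).drop (i + (p N).length).toNat).take w.length := by
      refine List.ext_getElem ?_ fun j hj hj' => ?_
      · simp only [List.length_take, List.length_drop, List.length_append]
        omega
      · have e₁ : w[j] = x (i + j) := by
          rw [List.getElem_of_eq hwi hj]
          simp
        rw [e₁, ← hN ⟨j, hj⟩, List.getElem_take, List.getElem_drop]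
        have hidx : (i + (j : ℕ) + (p N).length).toNat = (i + (p N).length).toNat + j := by omega
        simp only [y, hidx]
        rw [List.getD_eq_getElem]
    rw [hw']
    exact (List.take_prefix _ _).isInfix.trans (List.drop_suffix _ _).isInfix
  · obtain ⟨N, hN⟩ := (hx' 0 u.length).exists
    refine List.ext_getElem (by simp) fun j hj hj' => ?_
    simp only [List.getElem_ofFn]
    rw [← hN ⟨j, hj⟩]
    have hidx : (0 + ((j : ℕ) : ℤ) + (p N).length).toNat = (p N).length + j := by omega
    simp only [y, hidx]
    rw [List.getD_eq_getElem _ _ (by simp only [List.length_append]; omega)]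
    simp [hj]

end RandomSubstitution

/-! ### The complexity function -/

theorem finite_languageOf_length {A : Type*} [Finite A] (X : Set (ℤ → A)) (n : ℕ) :
    {u | u ∈ languageOf X ∧ u.length = n}.Finite :=
  (List.finite_length_eq A n).subset fun _ h => h.2

theorem mem_languageOf_of_infix {A : Type*} {X : Set (ℤ → A)} {u v : List A}
    (hv : v ∈ languageOf X) (hu : u ≠ []) (h : u <:+: v) : u ∈ languageOf X := by
  obtain ⟨x, hx, -, i, hi⟩ := hv
  obtain ⟨s, t, rfl⟩ := h
  refine ⟨x, hx, hu, i + s.length, List.ext_getElem (by simp) fun j hj _ => ?_⟩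
  have hj' : s.length + j < (s ++ u ++ t).length := by simp only [List.length_append]; omega
  have := List.getElem_of_eq hi hj'
  rw [List.getElem_append_left (by simp only [List.length_append]; omega),
    List.getElem_append_right (by omega)] at this
  simpa [add_assoc] using this

theorem complexity_pos {A : Type*} [Finite A] {X : Set (ℤ → A)} (hX : X.Nonempty) {n : ℕ}
    (hn : n ≠ 0) : 0 < complexity X n := by
  obtain ⟨x, hx⟩ := hX
  refine (Set.ncard_pos (finite_languageOf_length X n)).2
    ⟨List.ofFn fun j : Fin n => x (0 + (j : ℕ)), ⟨x, hx, by simpa using hn, 0, ?_⟩, by simp⟩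
  exact List.ext_getElem (by simp) (by simp)

theorem complexity_add_le {A : Type*} [Finite A] (X : Set (ℤ → A)) {m n : ℕ} (hm : m ≠ 0)
    (hn : n ≠ 0) : complexity X (m + n) ≤ complexity X m * complexity X n := by
  rw [complexity, complexity, complexity, ← Set.ncard_prod]
  refine Set.ncard_le_ncard_of_injOn (fun u => (u.take m, u.drop m)) ?_ ?_
    ((finite_languageOf_length X m).prod (finite_languageOf_length X n))
  · rintro u ⟨hu, hlen⟩
    have h₁ : (u.take m).length = m := by simp; omega
    have h₂ : (u.drop m).length = n := by simp; omega
    have hne₁ : u.take m ≠ [] := List.length_pos_iff.1 (by rw [h₁]; omega)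
    have hne₂ : u.drop m ≠ [] := List.length_pos_iff.1 (by rw [h₂]; omega)
    exact ⟨⟨mem_languageOf_of_infix hu hne₁ (List.take_prefix _ _).isInfix, h₁⟩,
      mem_languageOf_of_infix hu hne₂ (List.drop_suffix _ _).isInfix, h₂⟩
  · intro u _ v _ h
    rw [Prod.mk.injEq] at h
    rw [← List.take_append_drop m u, h.1, h.2, List.take_append_drop]

theorem subadditive_log_complexity {A : Type*} [Finite A] {X : Set (ℤ → A)} (hX : X.Nonempty) :
    Subadditive fun n => Real.log (complexity X n) := by
  intro m n
  -- The empty word is excluded from the language, so `complexity X 0 = 0` and its logarithm is `0`.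
  have h0 : complexity X 0 = 0 := by
    rw [complexity, Set.ncard_eq_zero (finite_languageOf_length X 0)]
    ext u
    simp only [Set.mem_ofPred_eq, Set.mem_empty_iff_false, iff_false, List.length_eq_zero_iff]
    rintro ⟨⟨x, -, hne, -⟩, h⟩
    exact hne h
  rcases eq_or_ne m 0 with rfl | hm
  · simp [h0]
  rcases eq_or_ne n 0 with rfl | hn
  · simp [h0]
  have hm' : (0 : ℝ) < complexity X m := by exact_mod_cast complexity_pos hX hm
  have hn' : (0 : ℝ) < complexity X n := by exact_mod_cast complexity_pos hX hn
  have hmn : (0 : ℝ) < complexity X (m + n) := by exact_mod_cast complexity_pos hX (by omega)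
  rw [← Real.log_mul hm'.ne' hn'.ne']
  exact Real.log_le_log hmn (by exact_mod_cast complexity_add_le X hm hn)

/-- Existence of the topological entropy, by Fekete's lemma. -/
theorem tendsto_topEntropy {A : Type*} [Finite A] {X : Set (ℤ → A)} (hX : X.Nonempty) :
    Tendsto (fun n : ℕ => 1 / (n : ℝ) * Real.log (complexity X n)) atTop (𝓝 (topEntropy X)) := by
  have h := (subadditive_log_complexity hX).tendsto_lim
    ⟨0, by
      rintro _ ⟨n, rfl⟩
      exact div_nonneg (Real.log_natCast_nonneg _) n.cast_nonneg⟩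
  refine tendsto_nhds_limUnder ⟨_, h.congr fun n => ?_⟩
  rw [one_div, div_eq_inv_mul]

/-- Words of length at most `n` extend to the right to words of length exactly `n`, so there are at
most `(n + 1) * p(n)` of them. -/
theorem ncard_le_mul_complexity {A : Type*} [Finite A] (X : Set (ℤ → A)) {n : ℕ}
    {W : Set (List A)} (hW : W ⊆ languageOf X) (hlen : ∀ u ∈ W, u.length ≤ n) :
    W.ncard ≤ (n + 1) * complexity X n := by
  have hext : ∀ u ∈ W, ∃ v, (v ∈ languageOf X ∧ v.length = n) ∧ u = v.take u.length := by
    intro u hu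
    obtain ⟨x, hx, hne, i, hi⟩ := hW hu
    have hpos := List.length_pos_iff.2 hne
    have hn := hlen u hu
    refine ⟨List.ofFn fun j : Fin n => x (i + (j : ℕ)), ⟨⟨x, hx, ?_, i, ?_⟩, by simp⟩, ?_⟩
    · exact List.length_pos_iff.1 (by simp; omega)
    · exact List.ext_getElem (by simp) (by simp)
    · refine List.ext_getElem (by simp; omega) fun j hj _ => ?_
      rw [List.getElem_of_eq hi hj]
      simp
  choose! e he hu using hext
  have hcard : (Set.Iio (n + 1)).ncard = n + 1 := by
    rw [← Finset.coe_Iio, Set.ncard_coe_finset, Nat.card_Iio]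
  rw [complexity, ← hcard, ← Set.ncard_prod]
  refine Set.ncard_le_ncard_of_injOn (fun u => (u.length, e u)) ?_ ?_
    ((Set.finite_Iio _).prod (finite_languageOf_length X n))
  · exact fun u h => ⟨Nat.lt_succ_of_le (hlen u h), he u h⟩
  · intro u h v h' huv
    rw [Prod.mk.injEq] at huv
    rw [hu u h, hu v h', huv.1, huv.2]

/-! ### Exponentially many realisations -/

namespace RandomSubstitution

variable {A : Type*} {ϑ : RandomSubstitution A}

theorem pow_count_le_ncard_image [DecidableEq A] (hurp : ϑ.HasUniqueRealisationPaths) {b : A}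
    (hb : 2 ≤ (ϑ.realisations b).card) {w : List A} (hw : w ∈ ϑ.language) :
    2 ^ w.count b ≤ (ϑ.image w).ncard := by
  have hinj := hurp w hw 1 le_rfl
  have hpow : ϑ.power 1 = fun a => (ϑ.realisations a : Set (List A)) := funext ϑ.power_one
  rw [hpow] at hinj
  have hprod : wordProduct (fun a => (ϑ.realisations a : Set (List A))) w =
      (Fintype.piFinset fun i => ϑ.realisations (w.get i) : Set (Fin w.length → List A)) := by
    ext f
    simp [wordProduct]
  have hcount (l : List A) : 2 ^ l.count b ≤ (l.map fun a => (ϑ.realisations a).card).prod := by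
    induction l with
    | nil => simp
    | cons a l ih =>
      rw [List.map_cons, List.prod_cons, List.count_cons, pow_add, mul_comm]
      refine Nat.mul_le_mul ?_ ih
      rcases eq_or_ne a b with rfl | h
      · simpa using hb
      · simpa [h] using (ϑ.realisations_nonempty a).card_pos
  rw [image, hinj.ncard_image, hprod, Set.ncard_coe_finset, Fintype.card_piFinset]
  refine (hcount w).trans_eq ?_
  rw [← List.prod_ofFn]
  congr 1
  exact List.ext_getElem (by simp) (by simp)

/-- For a constant `C`, the language contains `2 ^ n` words of length at most `C * n`, for every
positive `n`. -/
theorem exists_two_pow_le_ncard [Finite A] (hprim : ϑ.IsPrimitive)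
    (hurp : ϑ.HasUniqueRealisationPaths) {b : A} (hb : 2 ≤ (ϑ.realisations b).card) :
    ∃ C : ℕ, C ≠ 0 ∧ ∀ n : ℕ, n ≠ 0 → ∃ W ⊆ ϑ.language, (∀ u ∈ W, u.length ≤ C * n) ∧
      2 ^ n ≤ W.ncard := by
  classical
  obtain ⟨K, -, hK⟩ := hprim.exists_power
  choose g hg hbg using hK b
  obtain ⟨M, hM⟩ := Finite.exists_le fun c => (g c).length
  obtain ⟨R, hR⟩ := Finite.exists_le fun c => (ϑ.realisations c).sup List.length
  refine ⟨R * M + 1, by omega, fun n hn => ?_⟩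
  obtain ⟨y, hy, rfl⟩ := exists_mem_language_length hprim.subshift_nonempty hn
  have hw := flatMap_mem_language hy hg
  refine ⟨ϑ.image (y.flatMap g), image_subset_language hw, fun u hu => ?_, ?_⟩
  · rw [image_eq_wordImage] at hu
    have h₁ := length_le_of_mem_wordImage (M := R)
      (fun a r hr => (Finset.le_sup (f := List.length) hr).trans (hR a)) hu
    calc u.length ≤ R * (y.flatMap g).length := h₁
      _ ≤ R * (M * y.length) := Nat.mul_le_mul_left _ (length_flatMap_le hM y)
      _ ≤ (R * M + 1) * y.length := by rw [← mul_assoc]; gcongr; omega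
  · exact (Nat.pow_le_pow_right two_pos (length_le_count_flatMap hbg y)).trans
      (pow_count_le_ncard_image hurp hb hw)

end RandomSubstitution

theorem proposition3p5 {A : Type*} [Finite A] (ϑ : RandomSubstitution A)
    (hprim : ϑ.IsPrimitive) (hurp : ϑ.HasUniqueRealisationPaths)
    (hb : ∃ b : A, 2 ≤ (ϑ.realisations b).card) :
    Tendsto (fun n : ℕ => 1 / (n : ℝ) * Real.log (complexity ϑ.subshift n)) atTop
        (𝓝 (topEntropy ϑ.subshift)) ∧
      0 < topEntropy ϑ.subshift := by
  have hlim := tendsto_topEntropy hprim.subshift_nonempty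
  refine ⟨hlim, ?_⟩
  obtain ⟨b, hb⟩ := hb
  obtain ⟨C, hC, hW⟩ := RandomSubstitution.exists_two_pow_le_ncard hprim hurp hb
  have hC' : (0 : ℝ) < C := by exact_mod_cast Nat.pos_of_ne_zero hC
  have hsub : Tendsto (fun n : ℕ => C * n) atTop atTop :=
    tendsto_id.const_mul_atTop' (Nat.pos_of_ne_zero hC)
  have hlow : ∀ n : ℕ, n ≠ 0 → Real.log 2 / C - Real.log (2 * (C * n : ℕ)) / (C * n : ℕ) ≤
      1 / ((C * n : ℕ) : ℝ) * Real.log (complexity ϑ.subshift (C * n)) := by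
    intro n hn
    obtain ⟨W, hWL, hlen, hcard⟩ := hW n hn
    have hCn : C * n ≠ 0 := mul_ne_zero hC hn
    have hp := complexity_pos hprim.subshift_nonempty hCn
    have h := hcard.trans (ncard_le_mul_complexity ϑ.subshift
      (fun u hu => RandomSubstitution.mem_languageOf_subshift hprim (hWL hu)) hlen)
    have h' : 2 ^ n ≤ 2 * (C * n) * complexity ϑ.subshift (C * n) :=
      h.trans (Nat.mul_le_mul_right _ (by omega))
    have hp' : (0 : ℝ) < complexity ϑ.subshift (C * n) := by exact_mod_cast hp
    have hlog : n * Real.log 2 ≤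
        Real.log (2 * (C * n : ℕ)) + Real.log (complexity ϑ.subshift (C * n)) := by
      rw [← Real.log_mul (by positivity) hp'.ne', ← Real.log_pow]
      exact Real.log_le_log (by positivity) (by exact_mod_cast h')
    have hdiv : Real.log 2 / C = n * Real.log 2 / (C * n : ℕ) := by
      push_cast
      field_simp
    rw [hdiv, ← sub_div, one_div_mul_eq_div]
    gcongr
    linarith
  have hzero : Tendsto (fun n : ℕ => Real.log (2 * (C * n : ℕ)) / (C * n : ℕ)) atTop (𝓝 0) := by
    have h : Tendsto (fun x : ℝ => Real.log (2 * x) / x) atTop (𝓝 0) := by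
      have h₁ := (Real.isLittleO_log_id_atTop.tendsto_div_nhds_zero.comp
        (tendsto_id.const_mul_atTop (zero_lt_two (α := ℝ)))).const_mul 2
      rw [mul_zero] at h₁
      refine h₁.congr fun x => ?_
      simp only [Function.comp_apply, id]
      ring
    exact h.comp (tendsto_natCast_atTop_atTop.comp hsub)
  have hle : Real.log 2 / C - 0 ≤ topEntropy ϑ.subshift :=
    le_of_tendsto_of_tendsto (tendsto_const_nhds.sub hzero) (hlim.comp hsub)
      ((eventually_ne_atTop 0).mono hlow)
  have : 0 < Real.log 2 / C := div_pos (Real.log_pos one_lt_two) hC'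
  linarith
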